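/- Let $I_{\max}>0$ and let $\mathcal I=\{x\in\mathbb R^2:\|x\|_2\le I_{\max}\}$ be the set of safe currents. For $i=1,2$ let $q_i,\zeta_i\in\mathbb R$ and $a_i\in\mathbb R^2$ with $a_1,a_2$ linearly independent, and put $\mathbf M_i=\begin{bmatrix} q_i\mathbf I_2&\frac12 a_i\\ \frac12a_i^\top&\zeta_i\end{bmatrix}$, so that $\operatorname{Tr}(\mathbf M_i\mathbf W(x))=q_i\|x\|_2^2+a_i^\top x+\zeta_i$ for $\mathbf W(x)=\begin{bmatrix}x\\1\end{bmatrix}\begin{bmatrix}x^\top&1\end{bmatrix}$ (for instance two of the active power, the reactive power and the squared voltage of a converter behind a nondegenerate impedance, as functions of its current $x=\mathbf I_{\mathrm{dq}}$). Let $$\mathcal W=\{\mathbf W\in\mathbb S^3_+ : W_{11}+W_{22}\le I_{\max}^2,\ W_{33}=1\},$$ and let $f_0$ be convex and differentiable with $L$-Lipschitz gradient on $\{(\operatorname{Tr}(\mathbf M_1\mathbf W),\operatorname{Tr}(\mathbf M_2\mathbf W)):\mathbf W\in\mathcal W\}\subset\mathbb R^2$. For $\rho>0$ put $f(\mathbf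 W)=f_0(\operatorname{Tr}(\mathbf M_1\mathbf W),\operatorname{Tr}(\mathbf M_2\mathbf W))+\rho\operatorname{Tr}(\mathbf W)$ and $\nabla f(\mathbf W)=\partial_1f_0\,\mathbf M_1+\partial_2f_0\,\mathbf M_2+\rho\mathbf I_3$, the partial derivatives being taken at $(\operatorname{Tr}(\mathbf M_1\mathbf W),\operatorname{Tr}(\mathbf M_2\mathbf W))$. One step $x\mapsto y$ of the algorithm with step size $\alpha>0$ is as follows. (1) Let $\mathbf V$ be the point of $\mathcal W$ nearest, in the Frobenius norm, to $\mathbf W(x)-\alpha\nabla f(\mathbf W(x))$. (2) Put $s_i=\operatorname{Tr}(\mathbf M_i\mathbf V)$, let $\mathbf P$ be the matrix with rows $a_1^\top,a_2^\top$, and let $c=\mathbf P^{-1}(q_1,q_2)^\top$, $d=\mathbf P^{-1}(s_1-\zeta_1,s_2-\zeta_2)^\top$; let $\mu_1$ be the smallest root of $\|c\|_2^2\mu^2-(2d^\top c+1)\mu+\|d\|_2^2=0$ and set $y=d-\mu_1c$ (the current of smallest magnitude with outputs $s_1,s_2$). Then there is $\alpha_0>0$ such that for every $\rho>0$ there is a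 current $x^*\in\mathcal I$ such that $\mathbf W(x^*)$ minimizes $f$ over $\mathcal W$ (hence $x^*$ minimizes $f(\mathbf W(x))$ over $x\in\mathcal I$) and, for every $\alpha\in(0,\alpha_0)$: 1. for every $x^0\in\mathcal I$ the algorithm started at $x^0$ is well defined, that is, it generates exactly one sequence $(x^k)_{k\ge0}$; 2. every such sequence satisfies $x^k\in\mathcal I$ for all $k$ and $x^k\to x^*$; 3. $x^*$ is an asymptotically stable equilibrium of the algorithm on $\mathcal I$: it is a fixed point of the step; for every $\varepsilon>0$ there is $\delta>0$ such that $x^0\in\mathcal I$ and $\|x^0-x^*\|_2<\delta$ imply $\|x^k-x^*\|_2<\varepsilon$ for all $k$; and all sequences starting in $\mathcal I$ sufficiently close to $x^*$ converge to $x^*$. -/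

import Mathlib

namespace SafeConverter

open scoped Matrix

/-- A current `I_dq` (or a pair of outputs `(S₁, S₂)`): the plane with its Euclidean norm. -/
abbrev Plane : Type := EuclideanSpace ℝ (Fin 2)

abbrev Mat3 : Type := Matrix (Fin 3) (Fin 3) ℝ

/-- The safe operating region `𝓘`: all currents of magnitude at most `Imax`. -/
def safeSet (Imax : ℝ) : Set Plane := {x | ‖x‖ ^ 2 ≤ Imax ^ 2}

/-- The coefficients of a quadratic output `x ↦ q ‖x‖² + aᵀ x + ζ` of the current `x`.
With impedance `Z = [[R, -ωL], [ωL, R]]`, grid voltage `e = (E, 0)` and `J = [[0, 1], [-1, 0]]`: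
* active power: `q = 3/2 R`, `a = 3/2 e`, `ζ = 0`;
* reactive power: `q = 3/2 ωL`, `a = 3/2 J e`, `ζ = 0`;
* squared voltage: `q = R² + (ωL)²`, `a = 2 Zᵀ e`, `ζ = E²`. -/
structure Output where
  q : ℝ
  a : Fin 2 → ℝ
  ζ : ℝ

/-- The symmetric matrix `[[q I₂, a/2], [aᵀ/2, ζ]]`. -/
noncomputable def Output.mat (S : Output) : Mat3 :=
  !![S.q, 0, S.a 0 / 2;
     0, S.q, S.a 1 / 2;
     S.a 0 / 2, S.a 1 / 2, S.ζ]

/-- The feasible set `𝓦` of the semidefinite program. -/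
def feasible (Imax : ℝ) : Set Mat3 :=
  {W | W.PosSemidef ∧ W 0 0 + W 1 1 ≤ Imax ^ 2 ∧ W 2 2 = 1}

/-- The rank-one matrix `(x, 1)(x, 1)ᵀ` that represents the current `x`. -/
def lift (x : Plane) : Mat3 := Matrix.vecMulVec ![x 0, x 1, 1] ![x 0, x 1, 1]

/-- The pair `(Tr (M₁ W), Tr (M₂ W))`. -/
noncomputable def outputs (S₁ S₂ : Output) (W : Mat3) : Plane :=
  !₂[(S₁.mat * W).trace, (S₂.mat * W).trace]

/-- The set of all pairs `(Tr (M₁ W), Tr (M₂ W))` with `W ∈ 𝓦`. -/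
def outputRegion (Imax : ℝ) (S₁ S₂ : Output) : Set Plane :=
  outputs S₁ S₂ '' feasible Imax

/-- `f₀` is convex and differentiable with `L`-Lipschitz gradient on the set `D`. -/
def IsConvexSmooth (L : NNReal) (D : Set Plane) (f₀ : Plane → ℝ) : Prop :=
  ConvexOn ℝ D f₀ ∧ DifferentiableOn ℝ f₀ D ∧ LipschitzOnWith L (gradientWithin f₀ D) D

/-- `f(W) = f₀(Tr (M₁ W), Tr (M₂ W)) + ρ Tr W`. -/
noncomputable def objective (S₁ S₂ : Output) (f₀ : Plane → ℝ) (ρ : ℝ) (W : Mat3) : ℝ :=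
  f₀ (outputs S₁ S₂ W) + ρ * W.trace

/-- `∇f(W) = ∂₁f₀ M₁ + ∂₂f₀ M₂ + ρ I₃`, the partial derivatives being taken at
`(Tr (M₁ W), Tr (M₂ W))`. -/
noncomputable def gradObjective (Imax : ℝ) (S₁ S₂ : Output) (f₀ : Plane → ℝ) (ρ : ℝ)
    (W : Mat3) : Mat3 :=
  let g : Plane := gradientWithin f₀ (outputRegion Imax S₁ S₂) (outputs S₁ S₂ W)
  g 0 • S₁.mat + g 1 • S₂.mat + ρ • (1 : Mat3)

section Projection

attribute [local instance] Matrix.frobeniusNormedAddCommGroup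

/-- `V` is a nearest point to `Y` in `𝓦` for the Frobenius norm. -/
def IsProjection (Imax : ℝ) (Y V : Mat3) : Prop :=
  V ∈ feasible Imax ∧ ∀ W ∈ feasible Imax, ‖V - Y‖ ≤ ‖W - Y‖

end Projection

/-- The matrix `P` with rows `aᵀ` and `bᵀ`. -/
def rowMat (S₁ S₂ : Output) : Matrix (Fin 2) (Fin 2) ℝ := Matrix.of ![S₁.a, S₂.a]

/-- `c = P⁻¹ (q₁, q₂)`. -/
noncomputable def vecC (S₁ S₂ : Output) : Fin 2 → ℝ := (rowMat S₁ S₂)⁻¹ *ᵥ ![S₁.q, S₂.q]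

/-- `d = P⁻¹ (s₁ - ζ₁, s₂ - ζ₂)`, so that a current `x` has outputs `s` if and only if
`x = d - ‖x‖² c`. -/
noncomputable def vecD (S₁ S₂ : Output) (s : Plane) : Fin 2 → ℝ :=
  (rowMat S₁ S₂)⁻¹ *ᵥ ![s 0 - S₁.ζ, s 1 - S₂.ζ]

/-- The roots `μ` of `‖c‖² μ² - (2 dᵀc + 1) μ + ‖d‖² = 0`. -/
def magnitudeRoots (S₁ S₂ : Output) (s : Plane) : Set ℝ :=
  {μ | (vecC S₁ S₂ ⬝ᵥ vecC S₁ S₂) * μ ^ 2 - (2 * (vecD S₁ S₂ s ⬝ᵥ vecC S₁ S₂) + 1) * μ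
    + vecD S₁ S₂ s ⬝ᵥ vecD S₁ S₂ s = 0}

/-- `y = d - μ₁ c`, where `μ₁` is the smallest root: the extraction of a current from `V`. -/
def IsExtraction (S₁ S₂ : Output) (V : Mat3) (y : Plane) : Prop :=
  ∃ μ₁ : ℝ, IsLeast (magnitudeRoots S₁ S₂ (outputs S₁ S₂ V)) μ₁ ∧
    y = WithLp.toLp 2 (vecD S₁ S₂ (outputs S₁ S₂ V) - μ₁ • vecC S₁ S₂)

/-- One iteration `x ↦ y` of the algorithm: lift `x`, take a projected gradient step of size `α`
in `𝓦`, and extract the current `y` from the result. -/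
def IsStep (Imax : ℝ) (S₁ S₂ : Output) (f₀ : Plane → ℝ) (ρ α : ℝ) (x y : Plane) : Prop :=
  ∃ V : Mat3,
    IsProjection Imax (lift x - α • gradObjective Imax S₁ S₂ f₀ ρ (lift x)) V ∧
    IsExtraction S₁ S₂ V y

/-- `x` is an infinite trajectory of the relation `step` from `x₀`. -/
def IsRun (step : Plane → Plane → Prop) (x₀ : Plane) (x : ℕ → Plane) : Prop :=
  x 0 = x₀ ∧ ∀ k, step (x k) (x (k + 1))

/-- `z` is an asymptotically stable equilibrium of `step` on the state space `X`:
an equilibrium that is Lyapunov stable and attracts all trajectories starting near it. -/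
def IsAsymptoticallyStable (X : Set Plane) (step : Plane → Plane → Prop) (z : Plane) : Prop :=
  step z z ∧
  (∀ ε > 0, ∃ δ > 0, ∀ x₀ ∈ X, dist x₀ z < δ →
    ∀ x, IsRun step x₀ x → ∀ k, dist (x k) z < ε) ∧
  (∃ δ > 0, ∀ x₀ ∈ X, dist x₀ z < δ →
    ∀ x, IsRun step x₀ x → Filter.Tendsto x Filter.atTop (nhds z))

end SafeConverter

/-!
A feasible matrix `V` with `V₃₃ = 1` dominates the rank-one matrix of its last column, so
`V₁₁ + V₂₂ ≥ ‖column V‖²`. By the intermediate value theorem the quadratic equation of the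
extraction then has a root at most `V₁₁ + V₂₂`: extraction keeps the outputs and never increases
the magnitude, hence never increases `f`, and it decreases `f` strictly unless `V` already has rank
one. Therefore every minimizer of `f` over `𝓦` has rank one. By convexity the midpoint of two
minimizers is a minimizer too, and the midpoint of two distinct lifts is never a lift, so the
minimizer `lift z` is unique.

For small `α` a projected gradient step of length `r` decreases `f` by at least a multiple of `r²`
and ends within `O(r)` of the minimum. Extraction preserves both facts, so `x ↦ f (lift x)` is a
Lyapunov function whose values tend to the minimum, and compactness turns this into convergence and
stability.
-/

namespace SafeConverter

open Filter Topology
open scoped Matrix InnerProductSpace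

section QuadraticBounds

variable {E F : Type*} [NormedAddCommGroup E] [InnerProductSpace ℝ E]
  [NormedAddCommGroup F] [InnerProductSpace ℝ F]

/-- On `K`, the function `f` lies between its linearizations with slopes `g` and the same
linearizations plus `S ‖y - x‖²`. This is all that the analysis of a projected gradient step uses
about a convex function with Lipschitz gradient `g`. -/
structure HasQuadraticBounds (K : Set E) (f : E → ℝ) (g : E → E) (S : ℝ) : Prop where
  add_inner_le : ∀ x ∈ K, ∀ y ∈ K, f x + ⟪g x, y - x⟫_ℝ ≤ f y
  le_add_inner_add : ∀ x ∈ K, ∀ y ∈ K, f y ≤ f x + ⟪g x, y - x⟫_ℝ + S * ‖y - x‖ ^ 2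

theorem add_inner_gradientWithin_le [CompleteSpace E] {D : Set E} {f : E → ℝ}
    (hf : ConvexOn ℝ D f) {x y : E} (hd : DifferentiableWithinAt ℝ f D x) (hx : x ∈ D)
    (hy : y ∈ D) : f x + ⟪gradientWithin f D x, y - x⟫_ℝ ≤ f y := by
  have hmaps : Set.MapsTo (AffineMap.lineMap x y : ℝ → E) (Set.Icc 0 1) D :=
    fun _ ht => hf.1.lineMap_mem hx hy ht
  have hconv : ConvexOn ℝ (Set.Icc (0 : ℝ) 1) (f ∘ (AffineMap.lineMap x y : ℝ → E)) :=
    (hf.comp_affineMap (AffineMap.lineMap x y)).subset hmaps (convex_Icc 0 1)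
  have hgrad : HasFDerivWithinAt f (InnerProductSpace.toDual ℝ E (gradientWithin f D x)) D
      (AffineMap.lineMap x y (0 : ℝ)) := by
    simpa only [AffineMap.lineMap_apply_zero] using hd.hasGradientWithinAt.hasFDerivWithinAt
  have hslope := hconv.le_slope_of_hasDerivWithinAt (by simp) (by simp) one_pos
    (hgrad.comp_hasDerivWithinAt 0 AffineMap.hasDerivAt_lineMap.hasDerivWithinAt hmaps)
  simp only [InnerProductSpace.toDual_apply_apply, slope_def_field, Function.comp_apply,
    AffineMap.lineMap_apply_zero, AffineMap.lineMap_apply_one, sub_zero, div_one] at hslope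
  linarith

/-- The linearization at `y` bounds `f y - f x` by `⟪∇f y, y - x⟫`, and passing to `∇f x` costs
`L ‖y - x‖²`; the sharp constant `L / 2` is not needed here. -/
theorem hasQuadraticBounds_gradientWithin [CompleteSpace E] {D : Set E} {f : E → ℝ} {L : NNReal}
    (hf : ConvexOn ℝ D f) (hd : DifferentiableOn ℝ f D)
    (hL : LipschitzOnWith L (gradientWithin f D) D) :
    HasQuadraticBounds D f (gradientWithin f D) L where
  add_inner_le x hx y hy := add_inner_gradientWithin_le hf (hd x hx) hx hy
  le_add_inner_add x hx y hy := by
    set g := gradientWithin f D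
    have hback : f y - ⟪g y, y - x⟫_ℝ ≤ f x := by
      simpa only [← neg_sub y x, inner_neg_right, ← sub_eq_add_neg] using
        add_inner_gradientWithin_le hf (hd y hy) hy hx
    have hchange : ⟪g y, y - x⟫_ℝ - ⟪g x, y - x⟫_ℝ ≤ L * ‖y - x‖ ^ 2 :=
      calc ⟪g y, y - x⟫_ℝ - ⟪g x, y - x⟫_ℝ = ⟪g y - g x, y - x⟫_ℝ := (inner_sub_left _ _ _).symm
        _ ≤ ‖g y - g x‖ * ‖y - x‖ := real_inner_le_norm _ _
        _ ≤ L * ‖y - x‖ * ‖y - x‖ := by gcongr; exact hL.norm_sub_le hy hx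
        _ = L * ‖y - x‖ ^ 2 := by ring
    linarith

namespace HasQuadraticBounds

theorem comp_add {D : Set F} {f : F → ℝ} {g : F → F} {S : ℝ} (h : HasQuadraticBounds D f g S)
    (hS : 0 ≤ S) (T : E →ₗ[ℝ] F) {C : ℝ} (hT : ∀ a, ‖T a‖ ^ 2 ≤ C * ‖a‖ ^ 2) (ℓ : E →ₗ[ℝ] ℝ)
    {K : Set E} (hK : Set.MapsTo T K D) {G : E → E}
    (hG : ∀ x a, ⟪G x, a⟫_ℝ = ⟪g (T x), T a⟫_ℝ + ℓ a) :
    HasQuadraticBounds K (fun x => f (T x) + ℓ x) G (S * C) where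
  add_inner_le x hx y hy := by
    have := h.add_inner_le (T x) (hK hx) (T y) (hK hy)
    rw [hG, map_sub, map_sub]
    linarith
  le_add_inner_add x hx y hy := by
    have hbound := h.le_add_inner_add (T x) (hK hx) (T y) (hK hy)
    have hnorm : S * ‖T y - T x‖ ^ 2 ≤ S * C * ‖y - x‖ ^ 2 := by
      rw [← map_sub, mul_assoc]
      gcongr
      exact hT _
    rw [hG, map_sub, map_sub]
    linarith

variable {K : Set E} {f : E → ℝ} {g : E → E} {S α : ℝ} {x u v : E}

theorem mul_sub_le_of_projection (h : HasQuadraticBounds K f g S) (hα : 0 ≤ α) (hx : x ∈ K)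
    (hu : u ∈ K) (hv : v ∈ K) (hproj : 0 ≤ ⟪v - (x - α • g x), u - v⟫_ℝ) :
    α * (f v - f u) ≤ ⟪v - x, u - v⟫_ℝ + α * S * ‖v - x‖ ^ 2 := by
  have hlinear : ⟪g x, v - x⟫_ℝ - ⟪g x, u - x⟫_ℝ = -⟪g x, u - v⟫_ℝ := by
    rw [← inner_sub_right, ← inner_neg_right, sub_sub_sub_cancel_right, neg_sub]
  have hgap : f v - f u ≤ -⟪g x, u - v⟫_ℝ + S * ‖v - x‖ ^ 2 := by
    linarith [h.add_inner_le x hx u hu, h.le_add_inner_add x hx v hv]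
  rw [← sub_add, inner_add_left, real_inner_smul_left] at hproj
  linarith [mul_le_mul_of_nonneg_left hgap hα]

theorem mul_norm_sq_le_of_projection (h : HasQuadraticBounds K f g S) (hα : 0 ≤ α) (hx : x ∈ K)
    (hv : v ∈ K) (hproj : 0 ≤ ⟪v - (x - α • g x), x - v⟫_ℝ) :
    (1 - α * S) * ‖v - x‖ ^ 2 ≤ α * (f x - f v) := by
  have hself : ⟪v - x, x - v⟫_ℝ = -‖v - x‖ ^ 2 := by
    rw [← neg_sub v x, inner_neg_right, real_inner_self_eq_norm_sq]
  linarith [h.mul_sub_le_of_projection hα hx hx hv hproj]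

end HasQuadraticBounds

theorem inner_sub_nonneg_of_forall_norm_le {K : Set E} (hK : Convex ℝ K) {y v w : E} (hv : v ∈ K)
    (hmin : ∀ u ∈ K, ‖v - y‖ ≤ ‖u - y‖) (hw : w ∈ K) : 0 ≤ ⟪v - y, w - v⟫_ℝ := by
  have : Nonempty K := ⟨⟨v, hv⟩⟩
  have hinf : ‖y - v‖ = ⨅ u : K, ‖y - u‖ := by
    refine le_antisymm (le_ciInf fun u => ?_)
      (ciInf_le ⟨0, Set.forall_mem_range.2 fun _ => norm_nonneg _⟩ (⟨v, hv⟩ : K))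
    simpa only [norm_sub_rev y] using hmin u u.2
  have hle := (norm_eq_iInf_iff_real_inner_le_zero hK hv).1 hinf w hw
  rwa [← neg_sub v y, inner_neg_left, neg_nonpos] at hle

end QuadraticBounds

section Descent

theorem tendsto_of_sufficient_decrease {u r : ℕ → ℝ} {m c : ℝ} {ω : ℝ → ℝ} (hc : 0 < c)
    (hω : Tendsto ω (𝓝 0) (𝓝 0)) (hm : ∀ k, m ≤ u k)
    (hdecrease : ∀ k, c * r k ^ 2 ≤ u k - u (k + 1)) (hgap : ∀ k, u (k + 1) ≤ m + ω (r k)) :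
    Tendsto u atTop (𝓝 m) := by
  have hanti : Antitone u := antitone_nat_of_succ_le fun k =>
    sub_nonneg.1 ((by positivity : 0 ≤ c * r k ^ 2).trans (hdecrease k))
  have hlim : Tendsto u atTop (𝓝 (⨅ k, u k)) :=
    tendsto_atTop_ciInf hanti ⟨m, Set.forall_mem_range.2 hm⟩
  have hdiff : Tendsto (fun k => (u k - u (k + 1)) / c) atTop (𝓝 0) := by
    simpa using (hlim.sub (hlim.comp (tendsto_add_atTop_nat 1))).div_const c
  have hsq : Tendsto (fun k => r k ^ 2) atTop (𝓝 0) :=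
    squeeze_zero (fun k => sq_nonneg _) (fun k => (le_div_iff₀' hc).2 (hdecrease k)) hdiff
  have hr : Tendsto r atTop (𝓝 0) := by
    refine (tendsto_zero_iff_abs_tendsto_zero r).2 ?_
    simpa [Function.comp_def, Real.sqrt_sq_eq_abs] using hsq.sqrt
  refine (tendsto_add_atTop_iff_nat 1).1 (tendsto_of_tendsto_of_tendsto_of_le_of_le
    tendsto_const_nhds ?_ (fun k => hm (k + 1)) hgap)
  simpa using (hω.comp hr).const_add m

theorem exists_forall_lt_imp_dist_lt {X : Type*} [PseudoMetricSpace X] {K : Set X}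
    (hK : IsCompact K) {f : X → ℝ} (hf : ContinuousOn f K) {z : X}
    (hz : ∀ x ∈ K, f x ≤ f z → x = z) {ε : ℝ} (hε : 0 < ε) :
    ∃ b > f z, ∀ x ∈ K, f x < b → dist x z < ε := by
  have hfar : ∀ x ∈ K \ Metric.ball z ε, f z < f x := fun x hx => by
    by_contra! hle
    exact hx.2 (hz x hx.1 hle ▸ Metric.mem_ball_self hε)
  obtain ⟨b, hb, hle⟩ := (hK.diff Metric.isOpen_ball).exists_forall_le'
    (hf.mono Set.sdiff_subset) hfar
  refine ⟨b, hb, fun x hx hlt => ?_⟩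
  by_contra hball
  exact (hle x ⟨hx, hball⟩).not_gt hlt

end Descent

section Dynamics

variable {X : Set Plane} {step : Plane → Plane → Prop} {V : Plane → ℝ} {z x₀ : Plane}
  {x : ℕ → Plane}

theorem existsUnique_isRun (hstep : ∀ x, ∃! y, step x y) (x₀ : Plane) : ∃! x, IsRun step x₀ x := by
  choose φ hφ huniq using hstep
  refine ⟨fun k => φ^[k] x₀, ⟨rfl, fun k => ?_⟩, fun x hx => funext fun k => ?_⟩
  · simpa only [Function.iterate_succ_apply'] using hφ (φ^[k] x₀)
  · induction k with
    | zero => exact hx.1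
    | succ k ih => rw [Function.iterate_succ_apply', ← ih, huniq _ _ (hx.2 k)]

theorem IsRun.mem (hx : IsRun step x₀ x) (hmaps : ∀ x ∈ X, ∀ y, step x y → y ∈ X)
    (hx₀ : x₀ ∈ X) : ∀ k, x k ∈ X
  | 0 => hx.1 ▸ hx₀
  | k + 1 => hmaps _ (hx.mem hmaps hx₀ k) _ (hx.2 k)

/-- `V` is a Lyapunov function for `step` on the compact invariant set `X`: it does not increase
along steps, `z` is its only minimizer, and its values along every trajectory in `X` tend to the
minimum. -/
structure IsLyapunov (X : Set Plane) (step : Plane → Plane → Prop) (V : Plane → ℝ) (z : Plane) :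
    Prop where
  isCompact : IsCompact X
  continuousOn : ContinuousOn V X
  mem : z ∈ X
  eq_of_le : ∀ x ∈ X, V x ≤ V z → x = z
  mapsTo : ∀ x ∈ X, ∀ y, step x y → y ∈ X
  le_of_step : ∀ x ∈ X, ∀ y, step x y → V y ≤ V x
  tendsto_value : ∀ x₀ ∈ X, ∀ x, IsRun step x₀ x → Tendsto (fun k => V (x k)) atTop (𝓝 (V z))

namespace IsLyapunov

theorem step_self (h : IsLyapunov X step V z) (hstep : ∃ y, step z y) : step z z := by
  obtain ⟨y, hy⟩ := hstep
  have hyz := h.eq_of_le y (h.mapsTo z h.mem y hy) (h.le_of_step z h.mem y hy)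
  exact hyz ▸ hy

theorem antitone (h : IsLyapunov X step V z) (hx₀ : x₀ ∈ X) (hx : IsRun step x₀ x) :
    Antitone fun k => V (x k) :=
  antitone_nat_of_succ_le fun k => h.le_of_step _ (hx.mem h.mapsTo hx₀ k) _ (hx.2 k)

theorem tendsto (h : IsLyapunov X step V z) (hx₀ : x₀ ∈ X) (hx : IsRun step x₀ x) :
    Tendsto x atTop (𝓝 z) := by
  refine Metric.tendsto_nhds.2 fun ε hε => ?_
  obtain ⟨b, hb, hnear⟩ :=
    exists_forall_lt_imp_dist_lt h.isCompact h.continuousOn h.eq_of_le hε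
  filter_upwards [(h.tendsto_value x₀ hx₀ x hx).eventually_lt_const hb] with k hk
  exact hnear _ (hx.mem h.mapsTo hx₀ k) hk

theorem isAsymptoticallyStable (h : IsLyapunov X step V z) (hstep : ∃ y, step z y) :
    IsAsymptoticallyStable X step z := by
  refine ⟨h.step_self hstep, fun ε hε => ?_, 1, one_pos, fun x₀ hx₀ _ x hx => h.tendsto hx₀ hx⟩
  obtain ⟨b, hb, hnear⟩ :=
    exists_forall_lt_imp_dist_lt h.isCompact h.continuousOn h.eq_of_le hε
  obtain ⟨δ, hδ, hV⟩ := Metric.mem_nhdsWithin_iff.1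
    ((h.continuousOn z h.mem).eventually_lt_const hb)
  refine ⟨δ, hδ, fun x₀ hx₀ hdist x hx k => hnear _ (hx.mem h.mapsTo hx₀ k) ?_⟩
  calc V (x k) ≤ V (x 0) := h.antitone hx₀ hx k.zero_le
    _ < b := hx.1 ▸ hV ⟨hdist, hx₀⟩

end IsLyapunov

end Dynamics

section PosSemidef

theorem posSemidef_apply_sq_le_mul {n : Type*} {A : Matrix n n ℝ} (hA : A.PosSemidef) (i j : n) :
    A i j ^ 2 ≤ A i i * A j j := by
  have hminor := (hA.submatrix ![i, j]).det_nonneg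
  have hsymm : A j i = A i j := hA.isHermitian.apply i j
  simp only [Matrix.det_fin_two, Matrix.submatrix_apply, Matrix.cons_val_zero,
    Matrix.cons_val_one, hsymm] at hminor
  linarith

theorem isClosed_setOf_posSemidef {n : Type*} [Finite n] :
    IsClosed {A : Matrix n n ℝ | A.PosSemidef} := by
  have := Fintype.ofFinite n
  have hinter : {A : Matrix n n ℝ | A.PosSemidef} =
      {A | Aᴴ = A} ∩ ⋂ v : n → ℝ, {A | 0 ≤ star v ⬝ᵥ A *ᵥ v} := by
    ext A
    simp [Matrix.posSemidef_iff_dotProduct_mulVec, Matrix.IsHermitian]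
  rw [hinter]
  exact (isClosed_eq (by fun_prop) (by fun_prop)).inter
    (isClosed_iInter fun _ => isClosed_le (by fun_prop) (by fun_prop))

theorem posSemidef_sub_vecMulVec_col {n : Type*} [Finite n] {A : Matrix n n ℝ}
    (hA : A.PosSemidef) {k : n} (hk : A k k = 1) :
    (A - Matrix.vecMulVec (A.col k) (A.col k)).PosSemidef := by
  have := Fintype.ofFinite n
  classical
  set c := A.col k with hc
  have hrow : Pi.single k 1 ᵥ* A = c := by
    ext i
    simpa [hc] using hA.isHermitian.apply i k
  have hcol : (A - Matrix.vecMulVec c c).col k = 0 := by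
    ext i
    simp [hc, Matrix.vecMulVec_apply, hk]
  -- Congruence by `1 - e_k cᵀ` clears the `k`-th row and column and leaves the Schur complement.
  have hconj := hA.conjTranspose_mul_mul_same (1 - Matrix.vecMulVec (Pi.single k 1) c)
  convert hconj using 1
  simp [Matrix.sub_mul, Matrix.mul_sub, Matrix.vecMulVec_mul, Matrix.mul_vecMulVec, hrow, hcol]

end PosSemidef

section Frobenius

variable {m n : Type*} [Fintype m] [Fintype n]

attribute [local instance] Matrix.frobeniusNormedAddCommGroup

/-- The inner product `⟪A, B⟫ = Tr (Aᵀ B)`, whose norm is the Frobenius norm. It is not a global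
instance because matrices carry no preferred norm. -/
noncomputable abbrev frobeniusInnerProductSpace : InnerProductSpace ℝ (Matrix m n ℝ) where
  __ := Matrix.frobeniusNormedSpace
  inner A B := (Aᵀ * B).trace
  norm_sq_eq_re_inner A := by
    rw [Matrix.frobenius_norm_def, ← Real.sqrt_eq_rpow, Real.sq_sqrt (by positivity),
      Finset.sum_comm]
    simp [Matrix.trace, Matrix.mul_apply, pow_two]
  conj_inner_symm A B := by
    rw [conj_trivial, ← Matrix.trace_transpose, Matrix.transpose_mul, Matrix.transpose_transpose]
  add_left A B C := by rw [Matrix.transpose_add, Matrix.add_mul, Matrix.trace_add]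
  smul_left A B r := by simp

attribute [local instance] frobeniusInnerProductSpace

theorem inner_eq_trace (A B : Matrix m n ℝ) : ⟪A, B⟫_ℝ = (Aᵀ * B).trace := rfl

theorem frobenius_norm_le_trace {A : Matrix n n ℝ} (hA : A.PosSemidef) : ‖A‖ ≤ A.trace := by
  refine abs_le_of_sq_le_sq' ?_ hA.trace_nonneg |>.2
  calc ‖A‖ ^ 2 = ∑ i, ∑ j, A i j ^ 2 := by
        rw [Matrix.frobenius_norm_def, ← Real.sqrt_eq_rpow, Real.sq_sqrt (by positivity)]
        simp
    _ ≤ ∑ i, ∑ j, A i i * A j j := by gcongr; exact posSemidef_apply_sq_le_mul hA _ _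
    _ = A.trace ^ 2 := by rw [pow_two, Matrix.trace, Finset.sum_mul_sum]; rfl

end Frobenius

section Feasible

attribute [local instance] Matrix.frobeniusNormedAddCommGroup frobeniusInnerProductSpace

variable {Imax : ℝ} {W V Y : Mat3} {x y z : Plane}

/-- The current `(W₁₃, W₂₃)` in the last column of `W`, which is `x` when `W = lift x`. -/
def column (W : Mat3) : Plane := !₂[W 0 2, W 1 2]

/-- The relaxation `W₁₁ + W₂₂` of the squared magnitude, which is `‖x‖²` when `W = lift x`. -/
def sqMagnitude (W : Mat3) : ℝ := W 0 0 + W 1 1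

theorem column_lift (x : Plane) : column (lift x) = x := by
  ext i
  fin_cases i <;> simp [column, lift, Matrix.vecMulVec_apply]

theorem sqMagnitude_lift (x : Plane) : sqMagnitude (lift x) = ‖x‖ ^ 2 := by
  rw [EuclideanSpace.real_norm_sq_eq, Fin.sum_univ_two]
  simp [sqMagnitude, lift, Matrix.vecMulVec_apply, ← pow_two]

theorem column_midpoint (V W : Mat3) :
    column (midpoint ℝ V W) = midpoint ℝ (column V) (column W) := by
  ext i
  fin_cases i <;> simp [column, midpoint_eq_smul_add, mul_add]

theorem sqMagnitude_midpoint (V W : Mat3) :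
    sqMagnitude (midpoint ℝ V W) = midpoint ℝ (sqMagnitude V) (sqMagnitude W) := by
  simp only [sqMagnitude, midpoint_eq_smul_add, Matrix.smul_apply, Matrix.add_apply, smul_eq_mul]
  ring

theorem posSemidef_lift (x : Plane) : (lift x).PosSemidef := by
  simpa [lift] using Matrix.posSemidef_vecMulVec_self_star ![x 0, x 1, 1]

theorem lift_apply_two_two (x : Plane) : lift x 2 2 = 1 := by simp [lift, Matrix.vecMulVec_apply]

theorem lift_mem_feasible (hx : x ∈ safeSet Imax) : lift x ∈ feasible Imax :=
  ⟨posSemidef_lift x, (sqMagnitude_lift x).trans_le hx, lift_apply_two_two x⟩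

theorem feasible_nonempty (Imax : ℝ) : (feasible Imax).Nonempty :=
  ⟨lift 0, lift_mem_feasible (by simp [safeSet, sq_nonneg])⟩

theorem trace_eq_sqMagnitude_add_one (hW : W 2 2 = 1) : W.trace = sqMagnitude W + 1 := by
  simp [Matrix.trace, Fin.sum_univ_three, sqMagnitude, hW]

theorem convex_feasible (Imax : ℝ) : Convex ℝ (feasible Imax) := by
  intro A hA B hB a b ha hb hab
  refine ⟨(hA.1.smul ha).add (hB.1.smul hb), ?_, by simp [hA.2.2, hB.2.2, hab]⟩
  calc (a • A + b • B) 0 0 + (a • A + b • B) 1 1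
      = a * (A 0 0 + A 1 1) + b * (B 0 0 + B 1 1) := by simp; ring
    _ ≤ a * Imax ^ 2 + b * Imax ^ 2 := by gcongr; exacts [hA.2.1, hB.2.1]
    _ = Imax ^ 2 := by rw [← add_mul, hab, one_mul]

theorem norm_le_of_mem_feasible (hW : W ∈ feasible Imax) : ‖W‖ ≤ Imax ^ 2 + 1 :=
  calc ‖W‖ ≤ W.trace := frobenius_norm_le_trace hW.1
    _ = sqMagnitude W + 1 := trace_eq_sqMagnitude_add_one hW.2.2
    _ ≤ Imax ^ 2 + 1 := add_le_add_left hW.2.1 1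

theorem isCompact_feasible (Imax : ℝ) : IsCompact (feasible Imax) := by
  have : ProperSpace Mat3 := FiniteDimensional.proper ℝ Mat3
  refine Metric.isCompact_of_isClosed_isBounded ?_
    (isBounded_iff_forall_norm_le.2 ⟨_, fun W hW => norm_le_of_mem_feasible hW⟩)
  simp only [feasible, Set.ofPred_and]
  exact isClosed_setOf_posSemidef.inter ((isClosed_le (by fun_prop) (by fun_prop)).inter
    (isClosed_eq (by fun_prop) (by fun_prop)))

theorem isCompact_safeSet (Imax : ℝ) : IsCompact (safeSet Imax) := by
  have hball : safeSet Imax = Metric.closedBall 0 |Imax| := by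
    ext x
    simp [safeSet, sq_le_sq]
  exact hball ▸ isCompact_closedBall 0 _

theorem lift_column (h22 : W 2 2 = 1) :
    lift (column W) = Matrix.vecMulVec (W.col 2) (W.col 2) := by
  have hcol : ![column W 0, column W 1, 1] = W.col 2 := by
    ext i
    fin_cases i <;> simp [column, h22]
  rw [lift, hcol]

theorem posSemidef_sub_lift_column (hW : W.PosSemidef) (h22 : W 2 2 = 1) :
    (W - lift (column W)).PosSemidef :=
  lift_column h22 ▸ posSemidef_sub_vecMulVec_col hW h22

theorem trace_sub_lift_column (h22 : W 2 2 = 1) :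
    (W - lift (column W)).trace = sqMagnitude W - ‖column W‖ ^ 2 := by
  rw [Matrix.trace_sub, trace_eq_sqMagnitude_add_one h22,
    trace_eq_sqMagnitude_add_one (lift_apply_two_two _), sqMagnitude_lift, add_sub_add_right_eq_sub]

theorem norm_column_sq_le (hW : W.PosSemidef) (h22 : W 2 2 = 1) :
    ‖column W‖ ^ 2 ≤ sqMagnitude W := by
  rw [← sub_nonneg, ← trace_sub_lift_column h22]
  exact (posSemidef_sub_lift_column hW h22).trace_nonneg

theorem eq_lift_column_of_sqMagnitude_eq (hW : W.PosSemidef) (h22 : W 2 2 = 1)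
    (heq : sqMagnitude W = ‖column W‖ ^ 2) : W = lift (column W) := by
  rw [← sub_eq_zero, ← (posSemidef_sub_lift_column hW h22).trace_eq_zero_iff,
    trace_sub_lift_column h22, heq, sub_self]

/-- `sqMagnitude` is affine along the segment while `‖column ·‖²` is strictly convex, so a proper
segment between rank-one points leaves the rank-one set at its midpoint. -/
theorem eq_of_midpoint_lift_eq_lift (h : midpoint ℝ (lift x) (lift z) = lift y) : x = z := by
  have hcol : midpoint ℝ x z = y := by
    simpa only [column_midpoint, column_lift] using congrArg column h
  have hsq : midpoint ℝ (‖x‖ ^ 2) (‖z‖ ^ 2) = ‖midpoint ℝ x z‖ ^ 2 := by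
    simpa only [sqMagnitude_midpoint, sqMagnitude_lift, ← hcol] using congrArg sqMagnitude h
  rw [midpoint_eq_smul_add, midpoint_eq_smul_add, norm_smul, mul_pow, smul_eq_mul] at hsq
  have hpar := parallelogram_law_with_norm ℝ x z
  have hnorm : ‖x - z‖ * ‖x - z‖ = 0 := by
    norm_num at hsq
    linarith
  exact sub_eq_zero.1 (norm_eq_zero.1 (mul_self_eq_zero.1 hnorm))

theorem exists_isProjection (Imax : ℝ) (Y : Mat3) : ∃ V, IsProjection Imax Y V :=
  (isCompact_feasible Imax).exists_isMinOn (feasible_nonempty Imax)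
    (continuous_id.sub continuous_const).norm.continuousOn

theorem IsProjection.inner_nonneg (h : IsProjection Imax Y V) (hW : W ∈ feasible Imax) :
    0 ≤ ⟪V - Y, W - V⟫_ℝ :=
  inner_sub_nonneg_of_forall_norm_le (convex_feasible Imax) h.1 h.2 hW

theorem IsProjection.unique (h : IsProjection Imax Y V) (h' : IsProjection Imax Y W) : V = W := by
  have hsum : ⟪V - Y, W - V⟫_ℝ + ⟪W - Y, V - W⟫_ℝ = -‖V - W‖ ^ 2 := by
    rw [← real_inner_self_eq_norm_sq, ← neg_sub V W, inner_neg_right, neg_add_eq_sub,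
      ← inner_sub_left, sub_sub_sub_cancel_right, ← neg_sub V W, inner_neg_left]
  have hnorm : ‖V - W‖ ^ 2 = 0 :=
    le_antisymm (by linarith [h.inner_nonneg h'.1, h'.inner_nonneg h.1]) (sq_nonneg _)
  exact sub_eq_zero.1 (norm_eq_zero.1 (pow_eq_zero_iff two_ne_zero |>.1 hnorm))

end Feasible

section Extraction

variable {S₁ S₂ : Output} {Imax μ : ℝ} {W V : Mat3} {s x y : Plane}

theorem trace_mat_mul (S : Output) (hW : W.PosSemidef) (h22 : W 2 2 = 1) :
    (S.mat * W).trace = S.q * sqMagnitude W + S.a ⬝ᵥ column W + S.ζ := by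
  have h02 : W 2 0 = W 0 2 := hW.isHermitian.apply 0 2
  have h12 : W 2 1 = W 1 2 := hW.isHermitian.apply 1 2
  simp only [Matrix.trace_fin_three, Matrix.mul_apply, dotProduct, Fin.sum_univ_three,
    Fin.sum_univ_two]
  simp [Output.mat, sqMagnitude, column, h02, h12, h22]
  ring

theorem rowMat_mulVec_column (hW : W.PosSemidef) (h22 : W 2 2 = 1) :
    rowMat S₁ S₂ *ᵥ column W =
      ![outputs S₁ S₂ W 0 - S₁.ζ, outputs S₁ S₂ W 1 - S₂.ζ] - sqMagnitude W • ![S₁.q, S₂.q] := by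
  ext i
  fin_cases i <;>
    simp [rowMat, outputs, trace_mat_mul _ hW h22, Matrix.mulVec, mul_comm]

theorem isUnit_det_rowMat (hind : LinearIndependent ℝ ![S₁.a, S₂.a]) :
    IsUnit (rowMat S₁ S₂).det :=
  (Matrix.isUnit_iff_isUnit_det _).1 (Matrix.linearIndependent_rows_iff_isUnit.1 hind)

theorem vecD_outputs (hind : LinearIndependent ℝ ![S₁.a, S₂.a]) (hW : W.PosSemidef)
    (h22 : W 2 2 = 1) :
    vecD S₁ S₂ (outputs S₁ S₂ W) = column W + sqMagnitude W • vecC S₁ S₂ := by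
  rw [← sub_eq_iff_eq_add, vecD, vecC, ← Matrix.mulVec_smul, ← Matrix.mulVec_sub,
    ← rowMat_mulVec_column hW h22, Matrix.mulVec_mulVec,
    Matrix.nonsing_inv_mul _ (isUnit_det_rowMat hind), Matrix.one_mulVec]

theorem vecD_injective (hind : LinearIndependent ℝ ![S₁.a, S₂.a]) :
    Function.Injective (vecD S₁ S₂) := by
  intro s t hst
  have hinv : IsUnit (rowMat S₁ S₂)⁻¹ :=
    Matrix.isUnit_nonsing_inv_iff.2 ((Matrix.isUnit_iff_isUnit_det _).2 (isUnit_det_rowMat hind))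
  have hvec := Matrix.mulVec_injective_of_isUnit hinv hst
  ext i
  fin_cases i
  · simpa using congrFun hvec 0
  · simpa using congrFun hvec 1

theorem mem_magnitudeRoots_iff :
    μ ∈ magnitudeRoots S₁ S₂ s ↔ ‖WithLp.toLp 2 (vecD S₁ S₂ s - μ • vecC S₁ S₂)‖ ^ 2 = μ := by
  simp only [magnitudeRoots, Set.mem_ofPred_eq, dotProduct, EuclideanSpace.real_norm_sq_eq,
    Fin.sum_univ_two, Pi.sub_apply, Pi.smul_apply, smul_eq_mul]
  constructor <;> intro h <;> linear_combination h

theorem isClosed_magnitudeRoots (S₁ S₂ : Output) (s : Plane) :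
    IsClosed (magnitudeRoots S₁ S₂ s) :=
  isClosed_eq (by fun_prop) continuous_const

theorem nonneg_of_mem_magnitudeRoots (hμ : μ ∈ magnitudeRoots S₁ S₂ s) : 0 ≤ μ :=
  mem_magnitudeRoots_iff.1 hμ ▸ sq_nonneg _

theorem exists_mem_magnitudeRoots_le_sqMagnitude (hind : LinearIndependent ℝ ![S₁.a, S₂.a])
    (hV : V.PosSemidef) (h22 : V 2 2 = 1) :
    ∃ μ ∈ magnitudeRoots S₁ S₂ (outputs S₁ S₂ V), μ ≤ sqMagnitude V := by
  let φ : ℝ → ℝ := fun μ =>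
    ‖WithLp.toLp 2 (vecD S₁ S₂ (outputs S₁ S₂ V) - μ • vecC S₁ S₂)‖ ^ 2 - μ
  have hcolumn := norm_column_sq_le hV h22
  have hzero : 0 ≤ φ 0 := by simp [φ]
  have hend : φ (sqMagnitude V) ≤ 0 := by simpa [φ, vecD_outputs hind hV h22] using hcolumn
  obtain ⟨μ, hμ, hroot⟩ := intermediate_value_Icc' ((sq_nonneg _).trans hcolumn)
    (by fun_prop : ContinuousOn φ _) ⟨hend, hzero⟩
  exact ⟨μ, mem_magnitudeRoots_iff.2 (sub_eq_zero.1 hroot), hμ.2⟩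

theorem exists_isExtraction (hind : LinearIndependent ℝ ![S₁.a, S₂.a]) (hV : V.PosSemidef)
    (h22 : V 2 2 = 1) : ∃ y, IsExtraction S₁ S₂ V y := by
  obtain ⟨μ, hμ, -⟩ := exists_mem_magnitudeRoots_le_sqMagnitude hind hV h22
  exact ⟨_, _, (isClosed_magnitudeRoots _ _ _).isLeast_csInf ⟨μ, hμ⟩
    ⟨0, fun _ => nonneg_of_mem_magnitudeRoots⟩, rfl⟩

namespace IsExtraction

theorem unique (hx : IsExtraction S₁ S₂ V x) (hy : IsExtraction S₁ S₂ V y) : x = y := by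
  obtain ⟨μ, hμ, rfl⟩ := hx
  obtain ⟨ν, hν, rfl⟩ := hy
  rw [hμ.unique hν]

theorem isLeast_norm_sq (h : IsExtraction S₁ S₂ V y) :
    IsLeast (magnitudeRoots S₁ S₂ (outputs S₁ S₂ V)) (‖y‖ ^ 2) := by
  obtain ⟨μ, hμ, rfl⟩ := h
  rwa [mem_magnitudeRoots_iff.1 hμ.1]

theorem eq_vecD_sub (h : IsExtraction S₁ S₂ V y) :
    y = WithLp.toLp 2 (vecD S₁ S₂ (outputs S₁ S₂ V) - ‖y‖ ^ 2 • vecC S₁ S₂) := by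
  obtain ⟨μ, hμ, rfl⟩ := h
  rw [mem_magnitudeRoots_iff.1 hμ.1]

theorem outputs_lift (h : IsExtraction S₁ S₂ V y) (hind : LinearIndependent ℝ ![S₁.a, S₂.a]) :
    outputs S₁ S₂ (lift y) = outputs S₁ S₂ V := by
  apply vecD_injective hind
  rw [vecD_outputs hind (posSemidef_lift y) (lift_apply_two_two y), column_lift, sqMagnitude_lift]
  exact eq_sub_iff_add_eq.1 (congrArg WithLp.ofLp h.eq_vecD_sub)

theorem norm_sq_le (h : IsExtraction S₁ S₂ V y) (hind : LinearIndependent ℝ ![S₁.a, S₂.a])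
    (hV : V.PosSemidef) (h22 : V 2 2 = 1) : ‖y‖ ^ 2 ≤ sqMagnitude V := by
  obtain ⟨μ, hμ, hle⟩ := exists_mem_magnitudeRoots_le_sqMagnitude hind hV h22
  exact (h.isLeast_norm_sq.2 hμ).trans hle

theorem mem_safeSet (h : IsExtraction S₁ S₂ V y) (hind : LinearIndependent ℝ ![S₁.a, S₂.a])
    (hV : V ∈ feasible Imax) : y ∈ safeSet Imax :=
  (h.norm_sq_le hind hV.1 hV.2.2).trans hV.2.1

theorem eq_lift (h : IsExtraction S₁ S₂ V y) (hind : LinearIndependent ℝ ![S₁.a, S₂.a])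
    (hV : V.PosSemidef) (h22 : V 2 2 = 1) (heq : ‖y‖ ^ 2 = sqMagnitude V) : V = lift y := by
  have hcolumn : y = column V := by
    rw [h.eq_vecD_sub, heq, vecD_outputs hind hV h22, add_sub_cancel_right]
  rw [hcolumn] at heq ⊢
  exact eq_lift_column_of_sqMagnitude_eq hV h22 heq.symm

end IsExtraction

end Extraction

section Objective

attribute [local instance] Matrix.frobeniusNormedAddCommGroup frobeniusInnerProductSpace

variable {S₁ S₂ : Output} {f₀ : Plane → ℝ} {Imax ρ : ℝ} {L : NNReal} {V W : Mat3} {x y z : Plane}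

/-- The output map `outputs S₁ S₂`, bundled as a linear map. -/
noncomputable def outputsLinear (S₁ S₂ : Output) : Mat3 →ₗ[ℝ] Plane where
  toFun := outputs S₁ S₂
  map_add' A B := by ext i; fin_cases i <;> simp [outputs, Matrix.mul_add]
  map_smul' c A := by ext i; fin_cases i <;> simp [outputs]

theorem continuous_outputs (S₁ S₂ : Output) : Continuous (outputs S₁ S₂) := by
  unfold outputs
  fun_prop

/-- The constant in the quadratic upper bound for the objective: the Lipschitz constant `L` of
`∇f₀` times a bound for the squared operator norm of the output map. -/
noncomputable def smoothness (S₁ S₂ : Output) (L : NNReal) : ℝ :=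
  L * (‖S₁.mat‖ ^ 2 + ‖S₂.mat‖ ^ 2)

theorem smoothness_nonneg (S₁ S₂ : Output) (L : NNReal) : 0 ≤ smoothness S₁ S₂ L := by
  unfold smoothness
  positivity

theorem inner_mat (S : Output) (A : Mat3) : ⟪S.mat, A⟫_ℝ = (S.mat * A).trace := by
  have hsymm : S.matᵀ = S.mat := by
    ext i j
    fin_cases i <;> fin_cases j <;> rfl
  rw [inner_eq_trace, hsymm]

theorem norm_outputs_sq_le (S₁ S₂ : Output) (A : Mat3) :
    ‖outputs S₁ S₂ A‖ ^ 2 ≤ (‖S₁.mat‖ ^ 2 + ‖S₂.mat‖ ^ 2) * ‖A‖ ^ 2 := by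
  have hcauchy (S : Output) : (S.mat * A).trace ^ 2 ≤ ‖S.mat‖ ^ 2 * ‖A‖ ^ 2 := by
    rw [← inner_mat, ← mul_pow, ← sq_abs]
    exact pow_le_pow_left₀ (abs_nonneg _) (abs_real_inner_le_norm _ _) 2
  rw [EuclideanSpace.real_norm_sq_eq, Fin.sum_univ_two, add_mul]
  exact add_le_add (hcauchy S₁) (hcauchy S₂)

theorem inner_gradObjective (Imax : ℝ) (S₁ S₂ : Output) (f₀ : Plane → ℝ) (ρ : ℝ) (W A : Mat3) :
    ⟪gradObjective Imax S₁ S₂ f₀ ρ W, A⟫_ℝ =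
      ⟪gradientWithin f₀ (outputRegion Imax S₁ S₂) (outputs S₁ S₂ W), outputs S₁ S₂ A⟫_ℝ
        + ρ * A.trace := by
  have hone : ⟪(1 : Mat3), A⟫_ℝ = A.trace := by
    rw [inner_eq_trace, Matrix.transpose_one, Matrix.one_mul]
  rw [gradObjective, inner_add_left, inner_add_left, real_inner_smul_left, real_inner_smul_left,
    real_inner_smul_left, inner_mat, inner_mat, hone, PiLp.inner_apply, Fin.sum_univ_two]
  simp [outputs, mul_comm]

theorem hasQuadraticBounds_objective (hf₀ : IsConvexSmooth L (outputRegion Imax S₁ S₂) f₀) :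
    HasQuadraticBounds (feasible Imax) (objective S₁ S₂ f₀ ρ) (gradObjective Imax S₁ S₂ f₀ ρ)
      (smoothness S₁ S₂ L) :=
  (hasQuadraticBounds_gradientWithin hf₀.1 hf₀.2.1 hf₀.2.2).comp_add L.2 (outputsLinear S₁ S₂)
    (norm_outputs_sq_le S₁ S₂) (ρ • Matrix.traceLinearMap (Fin 3) ℝ ℝ) (Set.mapsTo_image _ _)
    (inner_gradObjective Imax S₁ S₂ f₀ ρ)

theorem convexOn_objective (hf₀ : ConvexOn ℝ (outputRegion Imax S₁ S₂) f₀) :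
    ConvexOn ℝ (feasible Imax) (objective S₁ S₂ f₀ ρ) :=
  ((hf₀.comp_linearMap (outputsLinear S₁ S₂)).subset (Set.mapsTo_image _ _)
    (convex_feasible Imax)).add
    ((ρ • Matrix.traceLinearMap (Fin 3) ℝ ℝ).convexOn (convex_feasible Imax))

theorem continuousOn_objective (hf₀ : ContinuousOn f₀ (outputRegion Imax S₁ S₂)) :
    ContinuousOn (objective S₁ S₂ f₀ ρ) (feasible Imax) :=
  (hf₀.comp (continuous_outputs S₁ S₂).continuousOn (Set.mapsTo_image _ _)).add
    (by fun_prop : Continuous fun W : Mat3 => ρ * W.trace).continuousOn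

theorem continuous_lift : Continuous lift := by
  unfold lift
  fun_prop

theorem IsExtraction.objective_lift (h : IsExtraction S₁ S₂ V y)
    (hind : LinearIndependent ℝ ![S₁.a, S₂.a]) (h22 : V 2 2 = 1) :
    objective S₁ S₂ f₀ ρ (lift y) =
      objective S₁ S₂ f₀ ρ V + ρ * (‖y‖ ^ 2 - sqMagnitude V) := by
  rw [objective, objective, h.outputs_lift hind, trace_eq_sqMagnitude_add_one h22,
    trace_eq_sqMagnitude_add_one (lift_apply_two_two y), sqMagnitude_lift]
  ring

theorem IsExtraction.objective_lift_le (h : IsExtraction S₁ S₂ V y)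
    (hind : LinearIndependent ℝ ![S₁.a, S₂.a]) (hρ : 0 ≤ ρ) (hV : V.PosSemidef)
    (h22 : V 2 2 = 1) : objective S₁ S₂ f₀ ρ (lift y) ≤ objective S₁ S₂ f₀ ρ V := by
  rw [h.objective_lift hind h22]
  exact add_le_of_nonpos_right
    (mul_nonpos_of_nonneg_of_nonpos hρ (sub_nonpos.2 (h.norm_sq_le hind hV h22)))

theorem exists_eq_lift_of_isMinOn (hind : LinearIndependent ℝ ![S₁.a, S₂.a]) (hρ : 0 < ρ)
    (hV : V ∈ feasible Imax) (hmin : IsMinOn (objective S₁ S₂ f₀ ρ) (feasible Imax) V) :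
    ∃ y ∈ safeSet Imax, V = lift y := by
  obtain ⟨y, hy⟩ := exists_isExtraction hind hV.1 hV.2.2
  have hsafe := hy.mem_safeSet hind hV
  have hle : objective S₁ S₂ f₀ ρ V ≤ objective S₁ S₂ f₀ ρ (lift y) :=
    hmin (lift_mem_feasible hsafe)
  rw [hy.objective_lift hind hV.2.2, le_add_iff_nonneg_right, mul_nonneg_iff_of_pos_left hρ,
    sub_nonneg] at hle
  exact ⟨y, hsafe, hy.eq_lift hind hV.1 hV.2.2
    (le_antisymm (hy.norm_sq_le hind hV.1 hV.2.2) hle)⟩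

theorem exists_isMinOn_lift (hind : LinearIndependent ℝ ![S₁.a, S₂.a]) (hρ : 0 < ρ)
    (hf₀ : ContinuousOn f₀ (outputRegion Imax S₁ S₂)) :
    ∃ z ∈ safeSet Imax, IsMinOn (objective S₁ S₂ f₀ ρ) (feasible Imax) (lift z) := by
  obtain ⟨V, hV, hmin⟩ := (isCompact_feasible Imax).exists_isMinOn (feasible_nonempty Imax)
    (continuousOn_objective (ρ := ρ) hf₀)
  obtain ⟨z, hz, rfl⟩ := exists_eq_lift_of_isMinOn hind hρ hV hmin
  exact ⟨z, hz, hmin⟩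

theorem eq_of_isMinOn_lift_of_le (hind : LinearIndependent ℝ ![S₁.a, S₂.a]) (hρ : 0 < ρ)
    (hf₀ : ConvexOn ℝ (outputRegion Imax S₁ S₂) f₀) (hx : x ∈ safeSet Imax)
    (hz : z ∈ safeSet Imax) (hmin : IsMinOn (objective S₁ S₂ f₀ ρ) (feasible Imax) (lift z))
    (hle : objective S₁ S₂ f₀ ρ (lift x) ≤ objective S₁ S₂ f₀ ρ (lift z)) : x = z := by
  have hmid := (convexOn_objective (ρ := ρ) hf₀).convex_le (objective S₁ S₂ f₀ ρ (lift z))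
    |>.midpoint_mem ⟨lift_mem_feasible hx, hle⟩ ⟨lift_mem_feasible hz, le_rfl⟩
  obtain ⟨y, -, hy⟩ := exists_eq_lift_of_isMinOn hind hρ hmid.1 fun W hW =>
    hmid.2.trans (hmin hW)
  exact eq_of_midpoint_lift_eq_lift hy

end Objective

section Step

attribute [local instance] Matrix.frobeniusNormedAddCommGroup frobeniusInnerProductSpace

variable {S₁ S₂ : Output} {f₀ : Plane → ℝ} {Imax ρ α : ℝ} {L : NNReal} {x y z : Plane}

theorem existsUnique_isStep (hind : LinearIndependent ℝ ![S₁.a, S₂.a]) (Imax : ℝ)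
    (f₀ : Plane → ℝ) (ρ α : ℝ) (x : Plane) : ∃! y, IsStep Imax S₁ S₂ f₀ ρ α x y := by
  obtain ⟨V, hV⟩ :=
    exists_isProjection Imax (lift x - α • gradObjective Imax S₁ S₂ f₀ ρ (lift x))
  obtain ⟨y, hy⟩ := exists_isExtraction hind hV.1.1 hV.1.2.2
  refine ⟨y, ⟨V, hV, hy⟩, ?_⟩
  rintro y' ⟨V', hV', hy'⟩
  obtain rfl := hV'.unique hV
  exact hy'.unique hy

theorem IsStep.mem_safeSet (h : IsStep Imax S₁ S₂ f₀ ρ α x y)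
    (hind : LinearIndependent ℝ ![S₁.a, S₂.a]) : y ∈ safeSet Imax := by
  obtain ⟨V, hV, hy⟩ := h
  exact hy.mem_safeSet hind hV.1

/-- Here `r` is the length `‖V - lift x‖` of the projected gradient step. -/
theorem IsStep.exists_bounds (h : IsStep Imax S₁ S₂ f₀ ρ α x y)
    (hind : LinearIndependent ℝ ![S₁.a, S₂.a])
    (hf₀ : IsConvexSmooth L (outputRegion Imax S₁ S₂) f₀) (hρ : 0 ≤ ρ) (hα : 0 ≤ α)
    (hx : x ∈ safeSet Imax) : ∃ r : ℝ,
      (1 - α * smoothness S₁ S₂ L) * r ^ 2 ≤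
        α * (objective S₁ S₂ f₀ ρ (lift x) - objective S₁ S₂ f₀ ρ (lift y)) ∧
      ∀ U ∈ feasible Imax, α * (objective S₁ S₂ f₀ ρ (lift y) - objective S₁ S₂ f₀ ρ U) ≤
        r * (2 * (Imax ^ 2 + 1)) + α * smoothness S₁ S₂ L * r ^ 2 := by
  obtain ⟨V, hV, hy⟩ := h
  have hbounds := hasQuadraticBounds_objective (ρ := ρ) hf₀
  have hlift := lift_mem_feasible hx
  have hextract := hy.objective_lift_le (f₀ := f₀) hind hρ hV.1.1 hV.1.2.2
  refine ⟨‖V - lift x‖, ?_, fun U hU => ?_⟩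
  · calc (1 - α * smoothness S₁ S₂ L) * ‖V - lift x‖ ^ 2
        ≤ α * (objective S₁ S₂ f₀ ρ (lift x) - objective S₁ S₂ f₀ ρ V) :=
          hbounds.mul_norm_sq_le_of_projection hα hlift hV.1 (hV.inner_nonneg hlift)
      _ ≤ _ := by gcongr
  · have hdiam : ‖U - V‖ ≤ 2 * (Imax ^ 2 + 1) := by
      linarith [norm_sub_le U V, norm_le_of_mem_feasible hU, norm_le_of_mem_feasible hV.1]
    calc α * (objective S₁ S₂ f₀ ρ (lift y) - objective S₁ S₂ f₀ ρ U)
        ≤ α * (objective S₁ S₂ f₀ ρ V - objective S₁ S₂ f₀ ρ U) := by gcongr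
      _ ≤ ⟪V - lift x, U - V⟫_ℝ + α * smoothness S₁ S₂ L * ‖V - lift x‖ ^ 2 :=
          hbounds.mul_sub_le_of_projection hα hlift hU hV.1 (hV.inner_nonneg hU)
      _ ≤ _ := by
          gcongr
          exact (real_inner_le_norm _ _).trans (by gcongr)

theorem tendsto_objective_lift (hind : LinearIndependent ℝ ![S₁.a, S₂.a])
    (hf₀ : IsConvexSmooth L (outputRegion Imax S₁ S₂) f₀) (hρ : 0 ≤ ρ) (hα : 0 < α)
    (hαL : α * smoothness S₁ S₂ L < 1) (hz : z ∈ safeSet Imax)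
    (hmin : IsMinOn (objective S₁ S₂ f₀ ρ) (feasible Imax) (lift z)) {x₀ : Plane}
    (hx₀ : x₀ ∈ safeSet Imax) {x : ℕ → Plane}
    (hx : IsRun (IsStep Imax S₁ S₂ f₀ ρ α) x₀ x) :
    Tendsto (fun k => objective S₁ S₂ f₀ ρ (lift (x k))) atTop
      (𝓝 (objective S₁ S₂ f₀ ρ (lift z))) := by
  have hsafe := hx.mem (fun _ _ _ h => h.mem_safeSet hind) hx₀
  choose r hdecrease hgap using fun k =>
    (hx.2 k).exists_bounds hind hf₀ hρ hα.le (hsafe k)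
  have hω : Tendsto (fun r => r * (2 * (Imax ^ 2 + 1)) + α * smoothness S₁ S₂ L * r ^ 2)
      (𝓝 0) (𝓝 0) :=
    Continuous.tendsto' (by fun_prop) 0 0 (by simp)
  refine (tendsto_const_smul_iff₀ hα.ne').1 (tendsto_of_sufficient_decrease (r := r)
    (sub_pos.2 hαL) hω (fun k => ?_) (fun k => ?_) (fun k => ?_))
  · exact mul_le_mul_of_nonneg_left (hmin (lift_mem_feasible (hsafe k))) hα.le
  · exact (hdecrease k).trans_eq (mul_sub _ _ _)
  · simpa only [smul_eq_mul, mul_sub, sub_le_iff_le_add'] using hgap k _ (lift_mem_feasible hz)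

theorem isLyapunov_objective (hind : LinearIndependent ℝ ![S₁.a, S₂.a])
    (hf₀ : IsConvexSmooth L (outputRegion Imax S₁ S₂) f₀) (hρ : 0 < ρ) (hα : 0 < α)
    (hαL : α * smoothness S₁ S₂ L < 1) (hz : z ∈ safeSet Imax)
    (hmin : IsMinOn (objective S₁ S₂ f₀ ρ) (feasible Imax) (lift z)) :
    IsLyapunov (safeSet Imax) (IsStep Imax S₁ S₂ f₀ ρ α)
      (fun x => objective S₁ S₂ f₀ ρ (lift x)) z where
  isCompact := isCompact_safeSet Imax
  continuousOn := (continuousOn_objective hf₀.2.1.continuousOn).comp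
    continuous_lift.continuousOn fun _ => lift_mem_feasible
  mem := hz
  eq_of_le _ hx hle := eq_of_isMinOn_lift_of_le hind hρ hf₀.1 hx hz hmin hle
  mapsTo _ _ _ h := h.mem_safeSet hind
  le_of_step x hx y h := by
    obtain ⟨r, hdecrease, -⟩ := h.exists_bounds hind hf₀ hρ.le hα.le hx
    have hr : 0 ≤ (1 - α * smoothness S₁ S₂ L) * r ^ 2 :=
      mul_nonneg (sub_pos.2 hαL).le (sq_nonneg r)
    exact sub_nonneg.1 (nonneg_of_mul_nonneg_right (hr.trans hdecrease) hα)
  tendsto_value _ hx₀ _ hx := tendsto_objective_lift hind hf₀ hρ.le hα hαL hz hmin hx₀ hx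

end Step

end SafeConverter

open SafeConverter

theorem theorem2 (Imax : ℝ) (hImax : 0 < Imax) (S₁ S₂ : SafeConverter.Output)
    (hind : LinearIndependent ℝ ![S₁.a, S₂.a]) (L : NNReal) (f₀ : SafeConverter.Plane → ℝ)
    (hf₀ : SafeConverter.IsConvexSmooth L (SafeConverter.outputRegion Imax S₁ S₂) f₀) :
    ∃ α₀ : ℝ, 0 < α₀ ∧ ∀ ρ : ℝ, 0 < ρ →
      ∃ z ∈ SafeConverter.safeSet Imax,
        IsMinOn (SafeConverter.objective S₁ S₂ f₀ ρ) (SafeConverter.feasible Imax)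
          (SafeConverter.lift z) ∧
        IsMinOn (fun x => SafeConverter.objective S₁ S₂ f₀ ρ (SafeConverter.lift x))
          (SafeConverter.safeSet Imax) z ∧
        ∀ α : ℝ, 0 < α → α < α₀ →
          (∀ x₀ ∈ SafeConverter.safeSet Imax,
            ∃! x, SafeConverter.IsRun (SafeConverter.IsStep Imax S₁ S₂ f₀ ρ α) x₀ x) ∧
          (∀ x₀ ∈ SafeConverter.safeSet Imax, ∀ x,
            SafeConverter.IsRun (SafeConverter.IsStep Imax S₁ S₂ f₀ ρ α) x₀ x →
              (∀ k, x k ∈ SafeConverter.safeSet Imax) ∧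
              Filter.Tendsto x Filter.atTop (nhds z)) ∧
          SafeConverter.IsAsymptoticallyStable (SafeConverter.safeSet Imax)
            (SafeConverter.IsStep Imax S₁ S₂ f₀ ρ α) z := by
  have hpos : 0 < smoothness S₁ S₂ L + 1 :=
    add_pos_of_nonneg_of_pos (smoothness_nonneg S₁ S₂ L) one_pos
  refine ⟨1 / (smoothness S₁ S₂ L + 1), one_div_pos.2 hpos, fun ρ hρ => ?_⟩
  obtain ⟨z, hz, hmin⟩ := exists_isMinOn_lift hind hρ hf₀.2.1.continuousOn
  refine ⟨z, hz, hmin, fun x hx => hmin (lift_mem_feasible hx), fun α hα hlt => ?_⟩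
  have hαL : α * smoothness S₁ S₂ L < 1 := by
    rw [lt_div_iff₀ hpos] at hlt
    linarith
  have hstep := existsUnique_isStep hind Imax f₀ ρ α
  have hV := isLyapunov_objective hind hf₀ hρ hα hαL hz hmin
  exact ⟨fun x₀ _ => existsUnique_isRun hstep x₀,
    fun x₀ hx₀ x hx => ⟨hx.mem hV.mapsTo hx₀, hV.tendsto hx₀ hx⟩,
    hV.isAsymptoticallyStable (hstep z).exists⟩
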